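/- Let $T^2=\mathbb R^2/(2\pi\mathbb Z)^2$ be the flat torus, and let $A$ be a smooth $U(1)$ connection on a Hermitian line bundle $E$ over $T^2$ with uniform magnetic field (curvature) $B=\partial_1A_2-\partial_2A_1=k/2\pi$, where $k=1$, so that $E$ has first Chern class $1$. Here sections of $E$ are the functions $\psi$ on $\mathbb R^2$ with $\psi(x+2\pi e_j)=e^{i\chi_j(x)}\psi(x)$ ($j=1,2$) for smooth real phases $\chi_j$ satisfying the cocycle condition, $A$ satisfies $A(x+2\pi e_j)=A(x)+\nabla\chi_j(x)$, and the covariant derivative is $D_j=\partial_j-iA_j$. Let $\phi_1^{\pm}$ be such that the holonomy of $A$ along the circle $t\mapsto(\phi_1^{\pm},t)$, $t\in[0,2\pi]$, equals $\pm1$, let $\phi_2^{\pm}$ be such that the holonomy of $A$ along the circle $t\mapsto(t,\phi_2^{\pm})$ equals $\pm1$, and put $\phi_{ab}=(\phi_1^a,\phi_2^b)$ for $a,b\in\{+,-\}$. Let $V$ be a bounded measurable real potential on $T^2$ that is $P_{++}$-symmetric, i.e. $V(2\phi_1^+-\varphi_1,\,2\phi_2^+-\varphi_2)=V(\varphi_1,\varphi_2)$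 for all $(\varphi_1,\varphi_2)$. Let $H_A=-\tfrac12(D_1^2+D_2^2)+V$, as the closure in $L^2(T^2,E)$ of its restriction to the smooth sections of $E$, and for $T>0$ let $K^A_T(x,y)=\langle x|e^{-TH_A}|y\rangle$ be the heat kernel, i.e. the continuous integral kernel of $e^{-TH_A}$ (a section of $E$ in $x$ and of the dual bundle $E^*$ in $y$). Then, for every $T>0$, $$K^A_T(\phi_{++},\phi_{--})=K^A_T(\phi_{+-},\phi_{--})=K^A_T(\phi_{-+},\phi_{--})=0 .$$ -/

import Mathlib

noncomputable section

namespace HallTorus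

open Real Set Filter Topology MeasureTheory
open scoped ContDiff

/-- A Hermitian line bundle over the flat torus `T² = ℝ² / (2πℤ)²` together with a `U(1)` connection
whose magnetic field is uniform and equal to `B = k / 2π`, described on the universal cover `ℝ²`.
Sections of the bundle are the functions `ψ` on `ℝ²` with
`ψ (x + 2π, y) = exp (i χ₁ (x, y)) ψ (x, y)` and `ψ (x, y + 2π) = exp (i χ₂ (x, y)) ψ (x, y)`;
`A = (A₁, A₂)` is the gauge potential, acting on sections through `∂ⱼ - i Aⱼ`.
The first Chern number is `B (2π)² / 2π = k`. -/
structure MagneticTorus (k : ℤ) where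
  A₁ : ℝ × ℝ → ℝ
  A₂ : ℝ × ℝ → ℝ
  χ₁ : ℝ × ℝ → ℝ
  χ₂ : ℝ × ℝ → ℝ
  smooth_A₁ : ContDiff ℝ ∞ A₁
  smooth_A₂ : ContDiff ℝ ∞ A₂
  smooth_χ₁ : ContDiff ℝ ∞ χ₁
  smooth_χ₂ : ContDiff ℝ ∞ χ₂
  /-- The two ways of translating by `(2π, 2π)` agree on sections. -/
  cocycle : ∀ x y : ℝ,
    Complex.exp (Complex.I * (χ₁ (x, y + 2 * π) + χ₂ (x, y) : ℝ)) =
      Complex.exp (Complex.I * (χ₂ (x + 2 * π, y) + χ₁ (x, y) : ℝ))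
  /-- The gauge potential changes by the gradient of the phase under each period. -/
  A₁_shift₁ : ∀ x y : ℝ, A₁ (x + 2 * π, y) = A₁ (x, y) + fderiv ℝ χ₁ (x, y) (1, 0)
  A₂_shift₁ : ∀ x y : ℝ, A₂ (x + 2 * π, y) = A₂ (x, y) + fderiv ℝ χ₁ (x, y) (0, 1)
  A₁_shift₂ : ∀ x y : ℝ, A₁ (x, y + 2 * π) = A₁ (x, y) + fderiv ℝ χ₂ (x, y) (1, 0)
  A₂_shift₂ : ∀ x y : ℝ, A₂ (x, y + 2 * π) = A₂ (x, y) + fderiv ℝ χ₂ (x, y) (0, 1)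
  /-- The curvature `∂₁A₂ - ∂₂A₁` is the constant `B = k / 2π`. -/
  curvature : ∀ p : ℝ × ℝ, fderiv ℝ A₂ p (1, 0) - fderiv ℝ A₁ p (0, 1) = (k : ℝ) / (2 * π)

namespace MagneticTorus

variable {k : ℤ} (M : MagneticTorus k)

/-- Holonomy of the connection along the circle `t ↦ (x, t)`, `0 ≤ t ≤ 2π`. The phase `χ₂` accounts
for the identification of the fibres over `(x, 0)` and `(x, 2π)`. -/
def holonomyα (x : ℝ) : ℂ :=
  Complex.exp (Complex.I * ((∫ t in (0 : ℝ)..2 * π, M.A₂ (x, t)) - M.χ₂ (x, 0) : ℝ))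

/-- Holonomy of the connection along the circle `t ↦ (t, y)`, `0 ≤ t ≤ 2π`. -/
def holonomyβ (y : ℝ) : ℂ :=
  Complex.exp (Complex.I * ((∫ t in (0 : ℝ)..2 * π, M.A₁ (t, y)) - M.χ₁ (0, y) : ℝ))

/-- Sections of the line bundle, as quasi-periodic functions on the plane. -/
def IsSection (ψ : ℝ × ℝ → ℂ) : Prop :=
  (∀ x y : ℝ, ψ (x + 2 * π, y) = Complex.exp (Complex.I * (M.χ₁ (x, y) : ℝ)) * ψ (x, y)) ∧
  (∀ x y : ℝ, ψ (x, y + 2 * π) = Complex.exp (Complex.I * (M.χ₂ (x, y) : ℝ)) * ψ (x, y))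

/-- Covariant derivative `∂₁ - i A₁`. -/
def D₁ (ψ : ℝ × ℝ → ℂ) (p : ℝ × ℝ) : ℂ :=
  fderiv ℝ ψ p (1, 0) - Complex.I * (M.A₁ p : ℝ) * ψ p

/-- Covariant derivative `∂₂ - i A₂`. -/
def D₂ (ψ : ℝ × ℝ → ℂ) (p : ℝ × ℝ) : ℂ :=
  fderiv ℝ ψ p (0, 1) - Complex.I * (M.A₂ p : ℝ) * ψ p

/-- The differential expression `H_A = -½ Δ_A + V`, where `Δ_A = D₁² + D₂²`. -/
def hamiltonian (V : ℝ × ℝ → ℝ) (ψ : ℝ × ℝ → ℂ) (p : ℝ × ℝ) : ℂ :=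
  -(1 / 2) * (M.D₁ (M.D₁ ψ) p + M.D₂ (M.D₂ ψ) p) + (V p : ℝ) * ψ p

end MagneticTorus

/-- Lebesgue measure on the fundamental domain `[0, 2π) × [0, 2π)`. -/
def torusMeasure : Measure (ℝ × ℝ) :=
  volume.restrict (Ico 0 (2 * π) ×ˢ Ico 0 (2 * π))

/-- The Hilbert space of states: square integrable sections. A section is determined by its
restriction to the fundamental domain. -/
abbrev StateSpace : Type := Lp ℂ 2 torusMeasure

namespace MagneticTorus

variable {k : ℤ} (M : MagneticTorus k) (V : ℝ × ℝ → ℝ)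

/-- Graph of `H_A` on the smooth sections, in the Hilbert space of states. -/
def smoothGraph : Set (StateSpace × StateSpace) :=
  {fg | ∃ u : ℝ × ℝ → ℂ, ContDiff ℝ ∞ u ∧ M.IsSection u ∧
    fg.1 =ᵐ[torusMeasure] u ∧ fg.2 =ᵐ[torusMeasure] M.hamiltonian V u}

/-- `S t = exp (-t H_A)` for `t ≥ 0`: `S` is the strongly continuous semigroup of bounded operators
on the space of states whose generator is `-H_A`, where `H_A` is the closure of the Hamiltonian on
smooth sections (which is its unique self-adjoint realization). -/
structure IsHeatSemigroup (S : ℝ → StateSpace →L[ℂ] StateSpace) : Prop where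
  zero : S 0 = ContinuousLinearMap.id ℂ StateSpace
  add : ∀ s t : ℝ, 0 ≤ s → 0 ≤ t → S (s + t) = (S s).comp (S t)
  strongly_continuous : ∀ f : StateSpace, Tendsto (fun t : ℝ => S t f) (𝓝[>] 0) (𝓝 f)
  generator : ∀ f g : StateSpace,
    Tendsto (fun t : ℝ => (t : ℂ)⁻¹ • (f - S t f)) (𝓝[>] 0) (𝓝 g) ↔
      (f, g) ∈ closure (M.smoothGraph V)

/-- `K T x y = ⟨x| exp (-T H_A) |y⟩` for `T > 0`: the continuous integral kernel of the heat
semigroup, a section of the line bundle in `x` and of its dual bundle in `y`. -/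
structure IsHeatKernel (K : ℝ → ℝ × ℝ → ℝ × ℝ → ℂ) : Prop where
  continuous : ∀ T : ℝ, 0 < T → Continuous (fun p : (ℝ × ℝ) × (ℝ × ℝ) => K T p.1 p.2)
  section_left : ∀ T : ℝ, 0 < T → ∀ y : ℝ × ℝ, M.IsSection (fun x => K T x y)
  section_right : ∀ T : ℝ, 0 < T → ∀ x : ℝ × ℝ,
    M.IsSection (fun y => (starRingEnd ℂ) (K T x y))
  kernel : ∃ S : ℝ → StateSpace →L[ℂ] StateSpace, M.IsHeatSemigroup V S ∧
    ∀ T : ℝ, 0 < T → ∀ f : StateSpace,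
      S T f =ᵐ[torusMeasure] fun x => ∫ y, K T x y * f y ∂torusMeasure

end MagneticTorus

end HallTorus

end

/-!
Let `c = φ₊₊`. Since the holonomies of `A` through `c` are real, the point reflection `p ↦ 2c - p`
of the torus preserves the connection up to a gauge transformation, so it lifts to a unitary
involution of the sections, the parity operator. It anticommutes with `D₁` and `D₂`, hence commutes
with `H_A` on the smooth sections, and then with the semigroup, because a bounded operator that
preserves the generator of a strongly continuous semigroup commutes with the semigroup. The heat
kernel is therefore invariant under the simultaneous action of parity on both of its arguments.

The reflection fixes the four points `c + π (m, n)`, `m, n ∈ {0, 1}`, over which parity acts on the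
fibre by the sign `(-1) ^ (k m n)`. For odd `k` the sign is `-1` exactly at `φ₋₋`, so the kernel
between `φ₋₋` and each of the other three points equals its own negative.
-/

noncomputable section

namespace HallTorus

open Real Set Filter Topology MeasureTheory
open scoped ContDiff

/-! ### Strongly continuous semigroups -/

section Semigroup

variable {E F : Type*} [NormedAddCommGroup E] [NormedSpace ℝ E]
  [NormedAddCommGroup F] [NormedSpace ℝ F]

/-- A strongly continuous one-parameter semigroup of bounded operators on a real normed space. The
values at negative times are irrelevant. -/
structure IsC0Semigroup (S : ℝ → E →L[ℝ] E) : Prop where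
  zero : S 0 = ContinuousLinearMap.id ℝ E
  add : ∀ s t : ℝ, 0 ≤ s → 0 ≤ t → S (s + t) = (S s).comp (S t)
  strongly_continuous : ∀ f : E, Tendsto (fun t : ℝ => S t f) (𝓝[>] 0) (𝓝 f)

/-- The graph of the infinitesimal generator of `S`: the pairs `(f, g)` for which the orbit of `f`
has right derivative `g` at time `0`. -/
def generatorGraph (S : ℝ → E →L[ℝ] E) : Set (E × E) :=
  {fg | HasDerivWithinAt (fun t => S t fg.1) fg.2 (Ici 0) 0}

theorem tendsto_clm_apply_of_norm_le {ι : Type*} {l : Filter ι} {B : ι → E →L[ℝ] F} {v : ι → E}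
    {v₀ : E} {w : F} {C : ℝ} (hB : ∀ᶠ i in l, ‖B i‖ ≤ C) (hv : Tendsto v l (𝓝 v₀))
    (hw : Tendsto (fun i => B i v₀) l (𝓝 w)) : Tendsto (fun i => B i (v i)) l (𝓝 w) := by
  have hdiff : Tendsto (fun i => B i (v i - v₀)) l (𝓝 0) := by
    refine squeeze_zero_norm' (hB.mono fun i hi => (B i).le_of_opNorm_le hi _) ?_
    simpa using ((hv.sub_const v₀).norm).const_mul C
  simpa using hdiff.add hw

theorem hasDerivWithinAt_clm_apply_of_norm_le {B : ℝ → E →L[ℝ] F} {e : ℝ → E} {s : Set ℝ} {x C : ℝ}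
    (hB : ∀ᶠ r in 𝓝[s] x, ‖B r‖ ≤ C) (he : HasDerivWithinAt e 0 s x) (hx : e x = 0) :
    HasDerivWithinAt (fun r => B r (e r)) 0 s x := by
  rw [hasDerivWithinAt_iff_isLittleO] at he ⊢
  simp only [hx, map_zero, sub_zero, smul_zero] at he ⊢
  exact (Asymptotics.IsBigO.of_bound C
    (hB.mono fun r hr => (B r).le_of_opNorm_le hr _)).trans_isLittleO he

namespace IsC0Semigroup

variable {S : ℝ → E →L[ℝ] E} {S' : ℝ → F →L[ℝ] F}

theorem add_apply (hS : IsC0Semigroup S) {s t : ℝ} (hs : 0 ≤ s) (ht : 0 ≤ t) (f : E) :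
    S (s + t) f = S s (S t f) := by
  rw [hS.add s t hs ht, ContinuousLinearMap.comp_apply]

theorem apply_sub_apply (hS : IsC0Semigroup S) {s t : ℝ} (hs : 0 ≤ s) (hst : s ≤ t) (f : E) :
    S (t - s) (S s f) = S t f := by
  rw [← hS.add_apply (sub_nonneg.2 hst) hs, sub_add_cancel]

theorem apply_nat_mul (hS : IsC0Semigroup S) {s : ℝ} (hs : 0 ≤ s) (n : ℕ) :
    S (n * s) = S s ^ n := by
  induction n with
  | zero => simpa [ContinuousLinearMap.one_def] using hS.zero
  | succ n ih =>
    rw [pow_succ, ← ih, Nat.cast_succ, add_one_mul, hS.add _ _ (by positivity) hs]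
    rfl

theorem tendsto_zero (hS : IsC0Semigroup S) (f : E) :
    Tendsto (fun t : ℝ => S t f) (𝓝[≥] 0) (𝓝 f) := by
  have hright : ContinuousWithinAt (fun t : ℝ => S t f) (Ioi 0) 0 := by
    simpa [ContinuousWithinAt, hS.zero] using hS.strongly_continuous f
  simpa [ContinuousWithinAt, hS.zero] using continuousWithinAt_Ioi_iff_Ici.1 hright

theorem exists_norm_le_near_zero [CompleteSpace E] (hS : IsC0Semigroup S) :
    ∃ δ > 0, ∃ C : ℝ, ∀ t, 0 ≤ t → t ≤ δ → ‖S t‖ ≤ C := by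
  by_contra! hcon
  choose t ht_nonneg ht_le ht_norm using fun n : ℕ => hcon (1 / ((n : ℝ) + 1)) (by positivity) n
  have ht : Tendsto t atTop (𝓝[≥] 0) := tendsto_nhdsWithin_iff.2
    ⟨squeeze_zero ht_nonneg ht_le tendsto_one_div_add_atTop_nhds_zero_nat,
      Eventually.of_forall ht_nonneg⟩
  obtain ⟨C, hC⟩ := banach_steinhaus (g := fun n => S (t n)) fun f => by
    obtain ⟨C, hC⟩ := ((hS.tendsto_zero f).comp ht).norm.bddAbove_range
    exact ⟨C, fun n => hC ⟨n, rfl⟩⟩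
  obtain ⟨n, hn⟩ := exists_nat_gt C
  linarith [ht_norm n, hC n]

theorem exists_norm_le [CompleteSpace E] (hS : IsC0Semigroup S) (T : ℝ) :
    ∃ C : ℝ, ∀ t, 0 ≤ t → t ≤ T → ‖S t‖ ≤ C := by
  obtain ⟨δ, hδ, C, hC⟩ := hS.exists_norm_le_near_zero
  obtain ⟨n, hn⟩ := exists_nat_gt (T / δ)
  refine ⟨C ^ (n + 1), fun t ht htT => ?_⟩
  have hstep : t / (n + 1 : ℕ) ≤ δ := by
    rw [div_lt_iff₀ hδ] at hn
    rw [div_le_iff₀ (by positivity)]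
    push_cast
    linarith
  calc ‖S t‖ = ‖S (t / (n + 1 : ℕ)) ^ (n + 1)‖ := by
        rw [← hS.apply_nat_mul (by positivity), mul_div_cancel₀ _ (by positivity)]
    _ ≤ ‖S (t / (n + 1 : ℕ))‖ ^ (n + 1) := norm_pow_le' _ n.succ_pos
    _ ≤ C ^ (n + 1) := by gcongr; exact hC _ (by positivity) hstep

theorem norm_sub_le (hS : IsC0Semigroup S) {C T s t : ℝ}
    (hC : ∀ t, 0 ≤ t → t ≤ T → ‖S t‖ ≤ C) (hs : 0 ≤ s) (hsT : s ≤ T) (ht : 0 ≤ t) (htT : t ≤ T)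
    (f : E) : ‖S t f - S s f‖ ≤ C * ‖S |t - s| f - f‖ := by
  wlog hst : s ≤ t generalizing s t
  · rw [norm_sub_rev, abs_sub_comm]
    exact this ht htT hs hsT (le_of_not_ge hst)
  have hfactor : S t f = S s (S (t - s) f) := by
    rw [← hS.add_apply hs (sub_nonneg.2 hst), add_sub_cancel]
  rw [abs_of_nonneg (sub_nonneg.2 hst), hfactor, ← map_sub]
  exact (S s).le_of_opNorm_le (hC s hs hsT) _

theorem continuousOn [CompleteSpace E] (hS : IsC0Semigroup S) (f : E) :
    ContinuousOn (fun t => S t f) (Ici 0) := by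
  intro s hs
  obtain ⟨C, hC⟩ := hS.exists_norm_le (s + 1)
  have hdist : Tendsto (fun t => |t - s|) (𝓝[Ici 0] s) (𝓝[≥] 0) := by
    refine tendsto_nhdsWithin_iff.2 ⟨?_, Eventually.of_forall fun t => abs_nonneg (t - s)⟩
    exact (Continuous.tendsto' (by fun_prop) s 0 (by simp)).mono_left nhdsWithin_le_nhds
  have hbound : Tendsto (fun t => C * ‖S |t - s| f - f‖) (𝓝[Ici 0] s) (𝓝 0) := by
    simpa using ((((hS.tendsto_zero f).comp hdist).sub_const f).norm).const_mul C
  rw [ContinuousWithinAt, tendsto_iff_norm_sub_tendsto_zero]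
  refine squeeze_zero' (Eventually.of_forall fun t => norm_nonneg _) ?_ hbound
  filter_upwards [self_mem_nhdsWithin,
    mem_nhdsWithin_of_mem_nhds (Iic_mem_nhds (lt_add_one s))] with t ht htT
  exact hS.norm_sub_le hC hs (by linarith) ht htT f

theorem intervalIntegrable [CompleteSpace E] (hS : IsC0Semigroup S) (f : E) {a b : ℝ}
    (ha : 0 ≤ a) (hb : 0 ≤ b) : IntervalIntegrable (fun t => S t f) volume a b :=
  ((hS.continuousOn f).mono fun _ ht => (le_min ha hb).trans ht.1).intervalIntegrable

theorem apply_mem_generatorGraph (hS : IsC0Semigroup S) {f g : E} (h : (f, g) ∈ generatorGraph S)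
    {s : ℝ} (hs : 0 ≤ s) : (S s f, S s g) ∈ generatorGraph S := by
  have hcomm : ∀ t ∈ Ici (0 : ℝ), S t (S s f) = S s (S t f) := fun t ht => by
    rw [← hS.add_apply hs ht, add_comm, hS.add_apply ht hs]
  exact ((S s).hasFDerivAt.comp_hasDerivWithinAt 0 h).congr hcomm (hcomm 0 self_mem_Ici)

theorem hasDerivWithinAt_orbit (hS : IsC0Semigroup S) {f g : E} (h : (f, g) ∈ generatorGraph S)
    {s : ℝ} (hs : 0 ≤ s) : HasDerivWithinAt (fun t => S t f) (S s g) (Ici s) s := by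
  have hshift : HasDerivWithinAt (fun t => S (t - s) (S s f)) ((1 : ℝ) • S s g) (Ici s) s :=
    HasDerivWithinAt.scomp_of_eq s (hS.apply_mem_generatorGraph h hs)
      ((hasDerivWithinAt_id s (Ici s)).sub_const s) (fun t ht => mem_Ici.2 (sub_nonneg.2 ht))
      (by simp)
  rw [one_smul] at hshift
  exact hshift.congr (fun t ht => (hS.apply_sub_apply hs ht f).symm)
    (hS.apply_sub_apply hs le_rfl f).symm

theorem hasDerivWithinAt_integral [CompleteSpace E] (hS : IsC0Semigroup S) (f : E) {s : ℝ}
    (hs : 0 ≤ s) : HasDerivWithinAt (fun u => ∫ t in (0 : ℝ)..u, S t f) (S s f) (Ici s) s := by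
  have hcont : ContinuousOn (fun t => S t f) (Ici s) :=
    (hS.continuousOn f).mono (Ici_subset_Ici.2 hs)
  refine intervalIntegral.integral_hasDerivWithinAt_right (hS.intervalIntegrable f le_rfl hs) ?_
    ((hcont s self_mem_Ici).mono Ioi_subset_Ici_self)
  exact ⟨Ici s, mem_of_superset self_mem_nhdsWithin Ioi_subset_Ici_self,
    hcont.aestronglyMeasurable measurableSet_Ici⟩

theorem apply_integral [CompleteSpace E] (hS : IsC0Semigroup S) (f : E) {h u : ℝ} (hh : 0 ≤ h)
    (hu : 0 ≤ u) : S u (∫ t in (0 : ℝ)..h, S t f) =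
      (∫ t in (0 : ℝ)..(h + u), S t f) - ∫ t in (0 : ℝ)..u, S t f := by
  calc S u (∫ t in (0 : ℝ)..h, S t f) = ∫ t in (0 : ℝ)..h, S u (S t f) :=
        (ContinuousLinearMap.intervalIntegral_comp_comm _ (hS.intervalIntegrable f le_rfl hh)).symm
    _ = ∫ t in (0 : ℝ)..h, S (t + u) f := by
        refine intervalIntegral.integral_congr fun t ht => ?_
        rw [uIcc_of_le hh] at ht
        simp only [add_comm t u, hS.add_apply hu ht.1]
    _ = ∫ t in u..(h + u), S t f := by
        rw [intervalIntegral.integral_comp_add_right (fun t => S t f), zero_add]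
    _ = _ := (intervalIntegral.integral_interval_sub_left
        (hS.intervalIntegrable f le_rfl (add_nonneg hh hu))
        (hS.intervalIntegrable f le_rfl hu)).symm

theorem integral_mem_generatorGraph [CompleteSpace E] (hS : IsC0Semigroup S) (f : E) {h : ℝ}
    (hh : 0 ≤ h) : (∫ t in (0 : ℝ)..h, S t f, S h f - f) ∈ generatorGraph S := by
  have hend : HasDerivWithinAt (fun u => ∫ t in (0 : ℝ)..(h + u), S t f) ((1 : ℝ) • S h f)
      (Ici 0) 0 :=
    HasDerivWithinAt.scomp_of_eq 0 (hS.hasDerivWithinAt_integral f hh)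
      ((hasDerivWithinAt_id 0 (Ici 0)).const_add h)
      (fun u hu => mem_Ici.2 (le_add_of_nonneg_right hu)) (by simp)
  have hstart := hS.hasDerivWithinAt_integral f le_rfl
  rw [one_smul] at hend
  rw [hS.zero] at hstart
  exact (hend.sub hstart).congr (fun u hu => hS.apply_integral f hh hu)
    (hS.apply_integral f hh le_rfl)

theorem dense_domain [CompleteSpace E] (hS : IsC0Semigroup S) :
    Dense (Prod.fst '' generatorGraph S) := by
  intro f
  have hmean : Tendsto (fun h : ℝ => h⁻¹ • ∫ t in (0 : ℝ)..h, S t f) (𝓝[>] 0) (𝓝 f) := by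
    have hderiv := (hS.hasDerivWithinAt_integral f le_rfl).mono Ioi_subset_Ici_self
    rw [hasDerivWithinAt_iff_tendsto_slope' self_notMem_Ioi, hS.zero] at hderiv
    simpa [slope_fun_def] using hderiv
  refine mem_closure_of_tendsto hmean (eventually_mem_nhdsWithin.mono fun h hh => ?_)
  refine ⟨(h⁻¹ • ∫ t in (0 : ℝ)..h, S t f, h⁻¹ • (S h f - f)), ?_, rfl⟩
  exact (HasDerivWithinAt.const_smul h⁻¹ (hS.integral_mem_generatorGraph f (le_of_lt hh))).congr
    (fun t _ => map_smul (S t) _ _) (map_smul (S 0) _ _)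

theorem continuousOn_interpolation [CompleteSpace E] [CompleteSpace F] (hS : IsC0Semigroup S)
    (hS' : IsC0Semigroup S') (P : E →L[ℝ] F) (t : ℝ) (f : E) :
    ContinuousOn (fun r => S' (t - r) (P (S r f))) (Icc 0 t) := by
  intro s hs
  obtain ⟨C, hC⟩ := hS'.exists_norm_le t
  refine tendsto_clm_apply_of_norm_le (C := C) ?_ ((P.continuous.comp_continuousOn
    (hS.continuousOn f) s hs.1).mono Icc_subset_Ici_self) ?_
  · filter_upwards [self_mem_nhdsWithin] with r hr
    exact hC _ (sub_nonneg.2 hr.2) (by linarith [hr.1])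
  · exact (hS'.continuousOn (P (S s f))).comp (f := fun r : ℝ => t - r) (s := Icc 0 t)
      (by fun_prop) (fun r hr => sub_nonneg.2 hr.2) s hs

theorem hasDerivWithinAt_interpolation [CompleteSpace F] (hS : IsC0Semigroup S)
    (hS' : IsC0Semigroup S') {P : E →L[ℝ] F}
    (hP : ∀ fg ∈ generatorGraph S, (P fg.1, P fg.2) ∈ generatorGraph S') {f g : E}
    (hfg : (f, g) ∈ generatorGraph S) {s t : ℝ} (hs : 0 ≤ s) (hst : s < t) :
    HasDerivWithinAt (fun r => S' (t - r) (P (S r f))) 0 (Ici s) s := by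
  obtain ⟨C, hC⟩ := hS'.exists_norm_le t
  have hlt : ∀ᶠ r in 𝓝[≥] s, r ≤ t := mem_nhdsWithin_of_mem_nhds (Iic_mem_nhds hst)
  have hB : ∀ᶠ r in 𝓝[≥] s, ‖S' (t - r)‖ ≤ C := by
    filter_upwards [self_mem_nhdsWithin, hlt] with r hr hrt
    exact hC _ (sub_nonneg.2 hrt) (by linarith [mem_Ici.1 hr])
  have hderivS : HasDerivWithinAt (fun r => P (S r f)) (P (S s g)) (Ici s) s :=
    P.hasFDerivAt.comp_hasDerivWithinAt s (hS.hasDerivWithinAt_orbit hfg hs)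
  have hderivS' : HasDerivWithinAt (fun r => S' (r - s) (P (S s f))) ((1 : ℝ) • P (S s g))
      (Ici s) s :=
    HasDerivWithinAt.scomp_of_eq s (hP _ (hS.apply_mem_generatorGraph hfg hs))
      ((hasDerivWithinAt_id s (Ici s)).sub_const s) (fun r hr => mem_Ici.2 (sub_nonneg.2 hr))
      (by simp)
  have hdefect := hderivS.sub hderivS'
  rw [one_smul, sub_self] at hdefect
  have hzero := hasDerivWithinAt_clm_apply_of_norm_le hB hdefect (by simp [hS'.zero])
  have hsplit : ∀ r, s ≤ r → r ≤ t → S' (t - r) (P (S r f)) =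
      S' (t - r) (P (S r f) - S' (r - s) (P (S s f))) + S' (t - s) (P (S s f)) := by
    intro r hsr hrt
    rw [map_sub, ← hS'.add_apply (sub_nonneg.2 hrt) (sub_nonneg.2 hsr), sub_add_sub_cancel,
      sub_add_cancel]
  refine (hzero.add_const (S' (t - s) (P (S s f)))).congr_of_eventuallyEq ?_
    (hsplit s le_rfl hst.le)
  filter_upwards [self_mem_nhdsWithin, hlt] with r hr hrt using hsplit r hr hrt

/-- For `f` in the domain, `r ↦ S' (t - r) (P (S r f))` joins the two sides with zero derivative. -/
theorem intertwine [CompleteSpace E] [CompleteSpace F] (hS : IsC0Semigroup S)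
    (hS' : IsC0Semigroup S') {P : E →L[ℝ] F}
    (hP : ∀ fg ∈ generatorGraph S, (P fg.1, P fg.2) ∈ generatorGraph S') {t : ℝ} (ht : 0 ≤ t)
    (f : E) : P (S t f) = S' t (P f) := by
  suffices h : P.comp (S t) = (S' t).comp P from DFunLike.congr_fun h f
  refine ContinuousLinearMap.coeFn_injective
    (Continuous.ext_on hS.dense_domain (P.comp (S t)).continuous ((S' t).comp P).continuous ?_)
  rintro _ ⟨⟨f, g⟩, hfg, rfl⟩
  have hconst := constant_of_has_deriv_right_zero (hS.continuousOn_interpolation hS' P t f)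
    (fun s hs => hS.hasDerivWithinAt_interpolation hS' hP hfg hs.1 hs.2) t ⟨ht, le_rfl⟩
  simpa [hS.zero, hS'.zero] using hconst

end IsC0Semigroup

end Semigroup

/-! ### Covariant derivatives -/

theorem exp_I_mul_eq_circleExp (t : ℝ) : Complex.exp (Complex.I * (t : ℝ)) = Circle.exp t := by
  rw [Circle.coe_exp, mul_comm]

theorem circleExp_pi : Circle.exp π = -1 := by
  ext
  simp [Circle.coe_exp, Complex.exp_pi_mul_I]

theorem conj_circle_smul (u : Circle) (z : ℂ) :
    (starRingEnd ℂ) (u • z) = u⁻¹ • (starRingEnd ℂ) z := by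
  rw [Circle.smul_def, Circle.smul_def, Circle.coe_inv_eq_conj, smul_eq_mul, smul_eq_mul, map_mul]

section CovariantDerivative

variable {E : Type*} [NormedAddCommGroup E] [NormedSpace ℝ E] {A θ χ : E → ℝ} {ψ : E → ℂ}
  {c p v w : E}

theorem contDiff_circleExp_smul {n : WithTop ℕ∞} (hθ : ContDiff ℝ n θ) (hψ : ContDiff ℝ n ψ) :
    ContDiff ℝ n fun q => Circle.exp (θ q) • ψ q := by
  simp only [Circle.smul_def, Circle.coe_exp, smul_eq_mul]
  exact ((Complex.ofRealCLM.contDiff.comp hθ).mul contDiff_const).cexp.mul hψ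

theorem fderiv_circleExp_smul (hθ : DifferentiableAt ℝ θ p) (hψ : DifferentiableAt ℝ ψ p) :
    fderiv ℝ (fun q => Circle.exp (θ q) • ψ q) p v =
      Circle.exp (θ p) • (fderiv ℝ ψ p v + Complex.I * (fderiv ℝ θ p v : ℝ) * ψ p) := by
  have hphase : HasFDerivAt (fun q => Complex.exp (θ q * Complex.I)) _ p :=
    ((Complex.ofRealCLM.hasFDerivAt.comp p hθ.hasFDerivAt).mul_const Complex.I).cexp
  simp only [Circle.smul_def, Circle.coe_exp, smul_eq_mul]
  rw [(hphase.fun_mul hψ.hasFDerivAt).fderiv]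
  simp only [Function.comp_apply, Complex.ofRealCLM_apply, ContinuousLinearMap.comp_apply,
    _root_.add_apply, _root_.smul_apply, smul_eq_mul]
  ring

/-- The covariant derivative `∂ᵥ - i A` in the direction `v`, where `A` is the component in the
direction `v` of the gauge potential. -/
def covDeriv (A : E → ℝ) (v : E) (ψ : E → ℂ) (p : E) : ℂ :=
  fderiv ℝ ψ p v - Complex.I * (A p : ℝ) * ψ p

theorem contDiff_covDeriv (hA : ContDiff ℝ ∞ A) (v : E) (hψ : ContDiff ℝ ∞ ψ) :
    ContDiff ℝ ∞ (covDeriv A v ψ) := by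
  have hderiv : ContDiff ℝ ∞ fun p => fderiv ℝ ψ p v :=
    (hψ.fderiv_right (m := ∞) (by simp)).clm_apply contDiff_const
  exact hderiv.sub ((contDiff_const.mul (Complex.ofRealCLM.contDiff.comp hA)).mul hψ)

theorem covDeriv_neg (A : E → ℝ) (v : E) (ψ : E → ℂ) : covDeriv A v (-ψ) = -covDeriv A v ψ := by
  funext p
  simp only [covDeriv, fderiv_neg, Pi.neg_apply, _root_.neg_apply]
  ring

theorem covDeriv_circleExp_smul (hθ : DifferentiableAt ℝ θ p) (hψ : DifferentiableAt ℝ ψ p) :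
    covDeriv A v (fun q => Circle.exp (θ q) • ψ q) p =
      Circle.exp (θ p) • covDeriv (fun q => A q - fderiv ℝ θ q v) v ψ p := by
  simp only [covDeriv, fderiv_circleExp_smul hθ hψ]
  simp only [Circle.smul_def, smul_eq_mul, Complex.ofReal_sub]
  ring

theorem covDeriv_comp_add_right (A : E → ℝ) (v : E) (ψ : E → ℂ) (w p : E) :
    covDeriv A v ψ (p + w) = covDeriv (fun q => A (q + w)) v (fun q => ψ (q + w)) p := by
  simp only [covDeriv, fderiv_comp_add_right]

theorem covDeriv_comp_sub_left (hψ : DifferentiableAt ℝ ψ (w - p)) :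
    covDeriv A v (fun q => ψ (w - q)) p = -covDeriv (fun q => -A (w - q)) v ψ (w - p) := by
  have hderiv : HasFDerivAt (fun q => ψ (w - q)) _ p :=
    hψ.hasFDerivAt.comp p ((hasFDerivAt_id p).const_sub w)
  simp only [covDeriv, hderiv.fderiv, sub_sub_cancel, Complex.ofReal_neg,
    ContinuousLinearMap.comp_apply, _root_.neg_apply, ContinuousLinearMap.id_apply, map_neg]
  ring

theorem covDeriv_translate (hχ : Differentiable ℝ χ) (hψ : Differentiable ℝ ψ)
    (hshift : ∀ q, ψ (q + w) = Circle.exp (χ q) • ψ q)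
    (hA : ∀ q, A (q + w) = A q + fderiv ℝ χ q v) (p : E) :
    covDeriv A v ψ (p + w) = Circle.exp (χ p) • covDeriv A v ψ p := by
  rw [covDeriv_comp_add_right, funext hshift, covDeriv_circleExp_smul (hχ p) (hψ p)]
  simp only [hA, add_sub_cancel_right]

/-- The reflection at the point `c`, twisted by the phase `θ`. -/
def twistedReflection (θ : E → ℝ) (c : E) (ψ : E → ℂ) (p : E) : ℂ :=
  Circle.exp (θ p) • ψ ((2 : ℝ) • c - p)

theorem contDiff_twistedReflection {n : WithTop ℕ∞} (hθ : ContDiff ℝ n θ) (c : E)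
    (hψ : ContDiff ℝ n ψ) : ContDiff ℝ n (twistedReflection θ c ψ) :=
  contDiff_circleExp_smul hθ (hψ.comp (contDiff_const.sub contDiff_id))

theorem covDeriv_twistedReflection (hθ : Differentiable ℝ θ) (hψ : Differentiable ℝ ψ)
    (hA : ∀ q, fderiv ℝ θ q v = A q + A ((2 : ℝ) • c - q)) :
    covDeriv A v (twistedReflection θ c ψ) = -twistedReflection θ c (covDeriv A v ψ) := by
  funext p
  have hpull : covDeriv A v (twistedReflection θ c ψ) p = _ :=
    covDeriv_circleExp_smul (hθ p) (by fun_prop : DifferentiableAt ℝ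
      (fun q => ψ ((2 : ℝ) • c - q)) p)
  rw [hpull, covDeriv_comp_sub_left (hψ _)]
  simp only [covDeriv, hA, sub_sub_cancel, twistedReflection, Pi.neg_apply, ← smul_neg]
  simp

end CovariantDerivative

/-! ### The Landau gauge -/

theorem fderiv_eq_smul_fst_add_smul_snd (f : ℝ × ℝ → ℝ) (p : ℝ × ℝ) :
    fderiv ℝ f p = fderiv ℝ f p (1, 0) • ContinuousLinearMap.fst ℝ ℝ ℝ +
      fderiv ℝ f p (0, 1) • ContinuousLinearMap.snd ℝ ℝ ℝ := by
  ext <;> simp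

theorem exists_primitive {u v : ℝ × ℝ → ℝ} (hu : ContDiff ℝ ∞ u) (hv : ContDiff ℝ ∞ v)
    (huv : ∀ p, fderiv ℝ v p (1, 0) = fderiv ℝ u p (0, 1)) :
    ∃ f : ℝ × ℝ → ℝ, ContDiff ℝ ∞ f ∧ ∀ p, HasFDerivAt f
      (u p • ContinuousLinearMap.fst ℝ ℝ ℝ + v p • ContinuousLinearMap.snd ℝ ℝ ℝ) p := by
  let η : ℝ × ℝ → ℝ × ℝ →L[ℝ] ℝ := fun p =>
    u p • ContinuousLinearMap.fst ℝ ℝ ℝ + v p • ContinuousLinearMap.snd ℝ ℝ ℝ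
  have hη : ContDiff ℝ ∞ η := by fun_prop
  have hη_fderiv : ∀ p a b, fderiv ℝ η p a b = fderiv ℝ u p a * b.1 + fderiv ℝ v p a * b.2 := by
    intro p a b
    have hderiv : HasFDerivAt η _ p :=
      ((hu.differentiable (by simp) p).hasFDerivAt.smul_const (ContinuousLinearMap.fst ℝ ℝ ℝ)).add
        ((hv.differentiable (by simp) p).hasFDerivAt.smul_const (ContinuousLinearMap.snd ℝ ℝ ℝ))
    rw [hderiv.fderiv]
    simp
  have hclosed : ∀ p ∈ univ, ∀ a b, fderiv ℝ η p a b = fderiv ℝ η p b a := by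
    intro p _ a b
    rw [hη_fderiv, hη_fderiv, fderiv_eq_smul_fst_add_smul_snd u,
      fderiv_eq_smul_fst_add_smul_snd v, huv]
    simp only [_root_.add_apply, _root_.smul_apply, ContinuousLinearMap.coe_fst',
      ContinuousLinearMap.coe_snd', smul_eq_mul]
    ring
  obtain ⟨f, hf⟩ := convex_univ.exists_forall_hasFDerivAt_of_fderiv_symmetric isOpen_univ
    (hη.differentiable (by simp)).differentiableOn hclosed
  have hfderiv : fderiv ℝ f = η := funext fun p => (hf p (mem_univ p)).fderiv
  exact ⟨f, contDiff_infty_iff_fderiv.2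
    ⟨fun p => (hf p (mem_univ p)).differentiableAt, hfderiv ▸ hη⟩, fun p => hf p (mem_univ p)⟩

theorem eq_add_const_of_hasFDerivAt {E F : Type*} [NormedAddCommGroup E] [NormedSpace ℝ E]
    [NormedAddCommGroup F] [NormedSpace ℝ F] {f g : E → F} {f' : E → E →L[ℝ] F}
    (hf : ∀ p, HasFDerivAt f (f' p) p) (hg : ∀ p, HasFDerivAt g (f' p) p) (p₀ p : E) :
    f p = g p + (f p₀ - g p₀) := by
  refine congrFun (_root_.eq_of_fderiv_eq (𝕜 := ℝ) (f := f) (g := fun p => g p + (f p₀ - g p₀))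
    (fun p => (hf p).differentiableAt) (fun p => (hg p).differentiableAt.add_const _)
    (fun p => ?_) p₀ (by simp)) p
  rw [(hf p).fderiv, ((hg p).add_const _).fderiv]

namespace MagneticTorus

variable {k : ℤ} (M : MagneticTorus k)

/-- A gauge transformation `Λ` bringing the connection into the Landau gauge
`A = (0, k x / 2π)`, in which the transition phases are `k y + a` and `b`. The constants `a` and `b`
are the remaining parameters of the connection. -/
structure LandauGauge where
  Λ : ℝ × ℝ → ℝ
  a : ℝ
  b : ℝ
  smooth : ContDiff ℝ ∞ Λ
  hasFDerivAt : ∀ p, HasFDerivAt Λ (M.A₁ p • ContinuousLinearMap.fst ℝ ℝ ℝ +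
    (M.A₂ p - k * p.1 / (2 * π)) • ContinuousLinearMap.snd ℝ ℝ ℝ) p
  shift_fst : ∀ p, Λ (p + (2 * π, 0)) = Λ p + M.χ₁ p - (k * p.2 + a)
  shift_snd : ∀ p, Λ (p + (0, 2 * π)) = Λ p + M.χ₂ p - b

theorem A₁_add_fst (p : ℝ × ℝ) : M.A₁ (p + (2 * π, 0)) = M.A₁ p + fderiv ℝ M.χ₁ p (1, 0) := by
  simpa [Prod.add_def] using M.A₁_shift₁ p.1 p.2

theorem A₂_add_fst (p : ℝ × ℝ) : M.A₂ (p + (2 * π, 0)) = M.A₂ p + fderiv ℝ M.χ₁ p (0, 1) := by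
  simpa [Prod.add_def] using M.A₂_shift₁ p.1 p.2

theorem A₁_add_snd (p : ℝ × ℝ) : M.A₁ (p + (0, 2 * π)) = M.A₁ p + fderiv ℝ M.χ₂ p (1, 0) := by
  simpa [Prod.add_def] using M.A₁_shift₂ p.1 p.2

theorem A₂_add_snd (p : ℝ × ℝ) : M.A₂ (p + (0, 2 * π)) = M.A₂ p + fderiv ℝ M.χ₂ p (0, 1) := by
  simpa [Prod.add_def] using M.A₂_shift₂ p.1 p.2

theorem exists_landau_potential : ∃ Λ : ℝ × ℝ → ℝ, ContDiff ℝ ∞ Λ ∧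
    ∀ p, HasFDerivAt Λ (M.A₁ p • ContinuousLinearMap.fst ℝ ℝ ℝ +
      (M.A₂ p - k * p.1 / (2 * π)) • ContinuousLinearMap.snd ℝ ℝ ℝ) p := by
  have hA₂ := M.smooth_A₂
  refine exists_primitive M.smooth_A₁ (by fun_prop) fun p => ?_
  have hderiv : HasFDerivAt (fun p : ℝ × ℝ => M.A₂ p - k * p.1 / (2 * π)) _ p :=
    (hA₂.differentiable (by simp) p).hasFDerivAt.sub
      ((hasFDerivAt_fst.const_mul (k : ℝ)).mul_const (2 * π)⁻¹)
  rw [hderiv.fderiv]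
  have hcurv := M.curvature p
  simp only [_root_.sub_apply, _root_.smul_apply, ContinuousLinearMap.coe_fst', smul_eq_mul]
  linear_combination hcurv

instance : Nonempty M.LandauGauge := by
  obtain ⟨Λ, hΛ, hderiv⟩ := M.exists_landau_potential
  have hderiv_add : ∀ e p, HasFDerivAt (fun q => Λ (q + e)) _ p := fun e p =>
    (hasFDerivAt_comp_add_right e).2 (hderiv (p + e))
  have hderiv_of_contDiff : ∀ χ : ℝ × ℝ → ℝ, ContDiff ℝ ∞ χ → ∀ p, HasFDerivAt χ
      (fderiv ℝ χ p (1, 0) • ContinuousLinearMap.fst ℝ ℝ ℝ +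
        fderiv ℝ χ p (0, 1) • ContinuousLinearMap.snd ℝ ℝ ℝ) p := fun χ hχ p =>
    fderiv_eq_smul_fst_add_smul_snd χ p ▸ (hχ.differentiable (by simp) p).hasFDerivAt
  have hfst : ∀ p, HasFDerivAt (fun q => Λ q + M.χ₁ q - k * q.2) _ p := fun p =>
    ((hderiv p).add (hderiv_of_contDiff _ M.smooth_χ₁ p)).sub
      (hasFDerivAt_snd.const_mul (k : ℝ))
  have hsnd : ∀ p, HasFDerivAt (fun q => Λ q + M.χ₂ q) _ p := fun p =>
    (hderiv p).add (hderiv_of_contDiff _ M.smooth_χ₂ p)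
  have hshift_fst := eq_add_const_of_hasFDerivAt (hderiv_add (2 * π, 0)) (fun p => by
    convert! hfst p using 1
    simp only [A₁_add_fst, A₂_add_fst, Prod.fst_add]
    match_scalars <;> field_simp
    ring) 0
  have hshift_snd := eq_add_const_of_hasFDerivAt (hderiv_add (0, 2 * π)) (fun p => by
    convert! hsnd p using 1
    simp only [A₁_add_snd, A₂_add_snd, Prod.fst_add, add_zero]
    module) 0
  simp only [zero_add, Prod.snd_zero, mul_zero, sub_zero] at hshift_fst hshift_snd
  exact ⟨Λ, Λ 0 + M.χ₁ 0 - Λ (2 * π, 0), Λ 0 + M.χ₂ 0 - Λ (0, 2 * π), hΛ, hderiv,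
    fun p => by rw [hshift_fst]; ring, fun p => by rw [hshift_snd]; ring⟩

end MagneticTorus

/-! ### Sections and the parity operator -/

theorem apply_add_zsmul_of_circleExp {G : Type*} [AddGroup G] {f : G → ℂ} {Λ τ : G → ℝ} {w : G}
    (hτ : ∀ p, τ (p + w) = τ p)
    (hf : ∀ p, f (p + w) = Circle.exp (Λ (p + w) - Λ p + τ p) • f p) (n : ℤ) (p : G) :
    f (p + n • w) = Circle.exp (Λ (p + n • w) - Λ p + n * τ p) • f p := by
  have hτn : ∀ n : ℤ, τ (p + n • w) = τ p := fun n => by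
    induction n using Int.induction_on with
    | zero => simp
    | succ n ih => rw [add_one_zsmul, ← add_assoc, hτ, ih]
    | pred n ih => rw [← ih, ← hτ, add_assoc, ← add_one_zsmul, sub_add_cancel]
  induction n using Int.induction_on with
  | zero => simp
  | succ n ih =>
    rw [add_one_zsmul, ← add_assoc, hf, ih, smul_smul, ← Circle.exp_add, hτn]
    congr 2
    push_cast
    ring
  | pred n ih =>
    have hstep := hf (p + (-(n : ℤ) - 1) • w)
    rw [add_assoc, ← add_one_zsmul, sub_add_cancel, ih, hτn, ← inv_smul_eq_iff, smul_smul,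
      ← Circle.exp_neg, ← Circle.exp_add] at hstep
    rw [← hstep]
    congr 2
    push_cast
    ring

namespace MagneticTorus

variable {k : ℤ} {M : MagneticTorus k} {ψ : ℝ × ℝ → ℂ} {V : ℝ × ℝ → ℝ}

theorem isSection_iff : M.IsSection ψ ↔
    (∀ p, ψ (p + (2 * π, 0)) = Circle.exp (M.χ₁ p) • ψ p) ∧
      ∀ p, ψ (p + (0, 2 * π)) = Circle.exp (M.χ₂ p) • ψ p := by
  simp only [IsSection, exp_I_mul_eq_circleExp, Circle.smul_def, smul_eq_mul, Prod.forall,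
    Prod.mk_add_mk, add_zero]

theorem IsSection.apply_add_fst (hψ : M.IsSection ψ) (p : ℝ × ℝ) :
    ψ (p + (2 * π, 0)) = Circle.exp (M.χ₁ p) • ψ p :=
  (isSection_iff.1 hψ).1 p

theorem IsSection.apply_add_snd (hψ : M.IsSection ψ) (p : ℝ × ℝ) :
    ψ (p + (0, 2 * π)) = Circle.exp (M.χ₂ p) • ψ p :=
  (isSection_iff.1 hψ).2 p

theorem isSection_covDeriv {A : ℝ × ℝ → ℝ} {v : ℝ × ℝ} (hψ : M.IsSection ψ)
    (hψ_diff : Differentiable ℝ ψ)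
    (hA_fst : ∀ p, A (p + (2 * π, 0)) = A p + fderiv ℝ M.χ₁ p v)
    (hA_snd : ∀ p, A (p + (0, 2 * π)) = A p + fderiv ℝ M.χ₂ p v) :
    M.IsSection (covDeriv A v ψ) :=
  isSection_iff.2
    ⟨covDeriv_translate (M.smooth_χ₁.differentiable (by simp)) hψ_diff hψ.apply_add_fst hA_fst,
      covDeriv_translate (M.smooth_χ₂.differentiable (by simp)) hψ_diff hψ.apply_add_snd hA_snd⟩

namespace LandauGauge

variable (L : M.LandauGauge)

theorem holonomyα_eq (x : ℝ) : M.holonomyα x = Circle.exp (k * x - L.b) := by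
  have hA₂ := M.smooth_A₂.continuous
  have hderiv : ∀ t : ℝ,
      HasDerivAt (fun t => L.Λ (x, t) + k * x / (2 * π) * t) (M.A₂ (x, t)) t := by
    intro t
    have hΛ := (L.hasFDerivAt (x, t)).comp_hasDerivAt t
      ((hasDerivAt_const t x).prodMk (hasDerivAt_id t))
    convert! hΛ.add ((hasDerivAt_id t).const_mul (k * x / (2 * π))) using 1
    simp
  have hint := intervalIntegral.integral_eq_sub_of_hasDerivAt (a := 0) (b := 2 * π)
    (fun t _ => hderiv t)
    ((by fun_prop : Continuous fun t => M.A₂ (x, t)).intervalIntegrable _ _)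
  have hshift := L.shift_snd (x, 0)
  rw [Prod.mk_add_mk, add_zero, zero_add] at hshift
  rw [holonomyα, exp_I_mul_eq_circleExp, hint, hshift]
  congr 2
  field_simp
  ring

theorem holonomyβ_eq (y : ℝ) : M.holonomyβ y = Circle.exp (-(k * y + L.a)) := by
  have hA₁ := M.smooth_A₁.continuous
  have hderiv : ∀ t : ℝ, HasDerivAt (fun t => L.Λ (t, y)) (M.A₁ (t, y)) t := by
    intro t
    have hΛ := (L.hasFDerivAt (t, y)).comp_hasDerivAt t
      ((hasDerivAt_id t).prodMk (hasDerivAt_const t y))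
    convert! hΛ using 1
    simp
  have hint := intervalIntegral.integral_eq_sub_of_hasDerivAt (a := 0) (b := 2 * π)
    (fun t _ => hderiv t)
    ((by fun_prop : Continuous fun t => M.A₁ (t, y)).intervalIntegrable _ _)
  have hshift := L.shift_fst (0, y)
  rw [Prod.mk_add_mk, add_zero, zero_add] at hshift
  rw [holonomyβ, exp_I_mul_eq_circleExp, hint, hshift]
  congr 2
  ring

/-- The phase by which a section changes under the translation by `(2πm, 2πn)`. -/
def latticePhase (m n : ℤ) (p : ℝ × ℝ) : ℝ :=
  L.Λ (p + m • (2 * π, 0) + n • (0, 2 * π)) - L.Λ p + m * (k * p.2 + L.a) + n * L.b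

theorem apply_add_lattice (hψ : M.IsSection ψ) (m n : ℤ) (p : ℝ × ℝ) :
    ψ (p + m • (2 * π, 0) + n • (0, 2 * π)) = Circle.exp (L.latticePhase m n p) • ψ p := by
  have hfst := apply_add_zsmul_of_circleExp (f := ψ) (Λ := L.Λ) (w := (2 * π, 0))
    (τ := fun p => k * p.2 + L.a) (by simp) (fun p => by
      rw [hψ.apply_add_fst, L.shift_fst]
      congr 2
      ring) m p
  have hsnd := apply_add_zsmul_of_circleExp (f := ψ) (Λ := L.Λ) (w := (0, 2 * π))
    (τ := fun _ => L.b) (fun _ => rfl) (fun p => by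
      rw [hψ.apply_add_snd, L.shift_snd]
      congr 2
      ring) n (p + m • (2 * π, 0))
  rw [hsnd, hfst, smul_smul, ← Circle.exp_add]
  congr 2
  simp only [latticePhase]
  ring

/-- The phase of the parity operator at `c`: its gradient is `A p + A (2c - p)`, so that the parity
operator anticommutes with the covariant derivatives. -/
def parityPhase (c p : ℝ × ℝ) : ℝ :=
  L.Λ p - L.Λ ((2 : ℝ) • c - p) + k * c.1 / π * (p.2 - c.2)

/-- The parity operator at `c`: the magnetic lift to sections of the point reflection
`p ↦ 2c - p` of the torus. -/
def parity (c : ℝ × ℝ) : (ℝ × ℝ → ℂ) → ℝ × ℝ → ℂ :=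
  twistedReflection (L.parityPhase c) c

theorem parityPhase_reflect (c p : ℝ × ℝ) :
    L.parityPhase c ((2 : ℝ) • c - p) = -L.parityPhase c p := by
  simp only [parityPhase, sub_sub_cancel, Prod.snd_sub, Prod.smul_snd, smul_eq_mul]
  ring

theorem contDiff_parityPhase (c : ℝ × ℝ) : ContDiff ℝ ∞ (L.parityPhase c) := by
  have hΛ := L.smooth
  unfold parityPhase
  fun_prop

theorem hasFDerivAt_parityPhase (c p : ℝ × ℝ) : HasFDerivAt (L.parityPhase c)
    ((M.A₁ p + M.A₁ ((2 : ℝ) • c - p)) • ContinuousLinearMap.fst ℝ ℝ ℝ +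
      (M.A₂ p + M.A₂ ((2 : ℝ) • c - p)) • ContinuousLinearMap.snd ℝ ℝ ℝ) p := by
  have hreflect := (L.hasFDerivAt ((2 : ℝ) • c - p)).comp p
    ((hasFDerivAt_id p).const_sub ((2 : ℝ) • c))
  rw [ContinuousLinearMap.comp_neg, ContinuousLinearMap.comp_id] at hreflect
  have hlinear : HasFDerivAt (fun p : ℝ × ℝ => k * c.1 / π * (p.2 - c.2))
      ((k * c.1 / π) • ContinuousLinearMap.snd ℝ ℝ ℝ) p :=
    (hasFDerivAt_snd.sub_const c.2).const_mul (k * c.1 / π)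
  convert! ((L.hasFDerivAt p).sub hreflect).add hlinear using 1
  simp only [Prod.fst_sub, Prod.smul_fst, smul_eq_mul]
  match_scalars <;> field_simp <;> ring

theorem contDiff_parity (c : ℝ × ℝ) (hψ : ContDiff ℝ ∞ ψ) : ContDiff ℝ ∞ (L.parity c ψ) :=
  contDiff_twistedReflection (L.contDiff_parityPhase c) c hψ

theorem D₁_parity (c : ℝ × ℝ) (hψ : Differentiable ℝ ψ) :
    M.D₁ (L.parity c ψ) = -L.parity c (M.D₁ ψ) :=
  covDeriv_twistedReflection (A := M.A₁) (v := (1, 0))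
    (fun p => (L.hasFDerivAt_parityPhase c p).differentiableAt) hψ
    fun p => by simp [(L.hasFDerivAt_parityPhase c p).fderiv]

theorem D₂_parity (c : ℝ × ℝ) (hψ : Differentiable ℝ ψ) :
    M.D₂ (L.parity c ψ) = -L.parity c (M.D₂ ψ) :=
  covDeriv_twistedReflection (A := M.A₂) (v := (0, 1))
    (fun p => (L.hasFDerivAt_parityPhase c p).differentiableAt) hψ
    fun p => by simp [(L.hasFDerivAt_parityPhase c p).fderiv]

theorem hamiltonian_parity {c : ℝ × ℝ} (hV : ∀ p, V ((2 : ℝ) • c - p) = V p)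
    (hψ : ContDiff ℝ ∞ ψ) :
    M.hamiltonian V (L.parity c ψ) = L.parity c (M.hamiltonian V ψ) := by
  have hψ_diff : Differentiable ℝ ψ := hψ.differentiable (by simp)
  have hD₁ : Differentiable ℝ (M.D₁ ψ) :=
    (contDiff_covDeriv M.smooth_A₁ (1, 0) hψ).differentiable (by simp)
  have hD₂ : Differentiable ℝ (M.D₂ ψ) :=
    (contDiff_covDeriv M.smooth_A₂ (0, 1) hψ).differentiable (by simp)
  have hD₁_neg : M.D₁ (-L.parity c (M.D₁ ψ)) = -M.D₁ (L.parity c (M.D₁ ψ)) := covDeriv_neg ..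
  have hD₂_neg : M.D₂ (-L.parity c (M.D₂ ψ)) = -M.D₂ (L.parity c (M.D₂ ψ)) := covDeriv_neg ..
  funext p
  simp only [hamiltonian, L.D₁_parity c hψ_diff, L.D₂_parity c hψ_diff, hD₁_neg, hD₂_neg,
    L.D₁_parity c hD₁, L.D₂_parity c hD₂, neg_neg]
  simp only [parity, twistedReflection, hamiltonian, hV, Circle.smul_def, smul_eq_mul]
  ring

theorem isSection_parity {c : ℝ × ℝ} (hα : M.holonomyα c.1 ^ 2 = 1)
    (hβ : M.holonomyβ c.2 ^ 2 = 1) (hψ : M.IsSection ψ) : M.IsSection (L.parity c ψ) := by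
  rw [L.holonomyα_eq, ← Circle.coe_pow, Circle.coe_eq_one, ← Circle.exp_natCast_mul] at hα
  rw [L.holonomyβ_eq, ← Circle.coe_pow, Circle.coe_eq_one, ← Circle.exp_natCast_mul] at hβ
  refine isSection_iff.2 ⟨fun p => ?_, fun p => ?_⟩
  · set q := (2 : ℝ) • c - (p + (2 * π, 0)) with hq
    have hreflect : (2 : ℝ) • c - p = q + (2 * π, 0) := by rw [hq]; abel
    have hphase : L.parityPhase c (p + (2 * π, 0)) =
        M.χ₁ p + (L.parityPhase c p + M.χ₁ q) + (2 : ℕ) * -(k * c.2 + L.a) := by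
      have hq_snd : q.2 = 2 * c.2 - p.2 := by simp [hq]
      simp only [parityPhase, ← hq, hreflect, L.shift_fst, hq_snd, Prod.snd_add, add_zero]
      push_cast
      ring
    simp only [parity, twistedReflection, ← hq, hreflect, hψ.apply_add_fst, hphase]
    simp only [Circle.exp_add, hβ, smul_smul, mul_one]
  · set q := (2 : ℝ) • c - (p + (0, 2 * π)) with hq
    have hreflect : (2 : ℝ) • c - p = q + (0, 2 * π) := by rw [hq]; abel
    have hphase : L.parityPhase c (p + (0, 2 * π)) =
        M.χ₂ p + (L.parityPhase c p + M.χ₂ q) + (2 : ℕ) * (k * c.1 - L.b) := by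
      simp only [parityPhase, ← hq, hreflect, L.shift_snd, Prod.snd_add]
      push_cast
      field_simp
      ring
    simp only [parity, twistedReflection, ← hq, hreflect, hψ.apply_add_snd, hphase]
    simp only [Circle.exp_add, hα, smul_smul, mul_one]

/-- Parity acts at the fixed points `c + π (m, n)` of the reflection by signs, given by the
holonomies at `c` and the flux through a quarter of the torus. -/
theorem parity_apply_half_period {c : ℝ × ℝ} (hα : M.holonomyα c.1 = 1)
    (hβ : M.holonomyβ c.2 = 1) (hψ : M.IsSection ψ) (m n : ℤ) :
    L.parity c ψ (c + m • (π, 0) + n • (0, π)) =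
      (-1 : ℂ) ^ (k * m * n) * ψ (c + m • (π, 0) + n • (0, π)) := by
  rw [L.holonomyα_eq, Circle.coe_eq_one] at hα
  rw [L.holonomyβ_eq, Circle.coe_eq_one] at hβ
  set p := c + m • ((π : ℝ), (0 : ℝ)) + n • ((0 : ℝ), (π : ℝ)) with hp
  set q := (2 : ℝ) • c - p with hq
  have hpq : p = q + m • (2 * π, 0) + n • (0, 2 * π) := by
    rw [hq, hp]
    ext <;> simp only [Prod.smul_mk, zsmul_eq_mul, smul_zero, Prod.fst_add, Prod.snd_add, add_zero,
      Prod.fst_sub, Prod.snd_sub, Prod.smul_fst, Prod.smul_snd, smul_eq_mul] <;> ring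
  have hsign : Circle.exp (π * (k * m * n : ℤ)) = (-1) ^ (k * m * n) := by
    rw [mul_comm, Circle.exp_intCast_mul, circleExp_pi]
  have hphase : L.parityPhase c p = L.latticePhase m n q + n * (k * c.1 - L.b) +
      m * -(k * c.2 + L.a) + π * (k * m * n : ℤ) := by
    have hp_snd : p.2 = c.2 + n * π := by simp [hp]
    have hq_snd : q.2 = c.2 - n * π := by
      simp only [hq, Prod.snd_sub, Prod.smul_snd, smul_eq_mul, hp_snd]
      ring
    simp only [parityPhase, latticePhase, ← hq, ← hpq, hp_snd, hq_snd]
    push_cast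
    field_simp
    ring
  have hψp : ψ p = Circle.exp (L.latticePhase m n q) • ψ q := by
    conv_lhs => rw [hpq]
    exact L.apply_add_lattice hψ m n q
  rw [hψp, parity, twistedReflection, ← hq, hphase]
  simp only [Circle.exp_add, Circle.exp_intCast_mul, hα, hβ, hsign, one_zpow, mul_one]
  simp only [Circle.smul_def, Circle.coe_mul, Circle.coe_zpow, Circle.coe_neg, Circle.coe_one,
    smul_eq_mul]
  ring

end LandauGauge

end MagneticTorus

/-! ### The fundamental domain and the parity operator on states -/

section Measure

variable {α β 𝕜 E : Type*} [MeasurableSpace α] [MeasurableSpace β] {μ : Measure α} {ν : Measure β}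

theorem exists_weightedComposition [NontriviallyNormedField 𝕜] [NormedAddCommGroup E]
    [NormedSpace 𝕜 E] {p : ENNReal} [Fact (1 ≤ p)] {σ : α → β} {w : α → 𝕜}
    (hσ : MeasurePreserving σ μ ν) (hw : MemLp w ⊤ μ) :
    ∃ P : Lp E p ν →L[𝕜] Lp E p μ, ∀ f : Lp E p ν, P f =ᵐ[μ] fun x => w x • f (σ x) := by
  let smul := ContinuousLinearMap.lsmul 𝕜 𝕜 (E := E)
  refine ⟨(smul.holderL μ ⊤ p p hw.toLp).comp
    (Lp.compMeasurePreservingₗᵢ 𝕜 σ hσ).toContinuousLinearMap, fun f => ?_⟩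
  filter_upwards [smul.coeFn_holder (r := p) hw.toLp (Lp.compMeasurePreserving σ hσ f),
    hw.coeFn_toLp, Lp.coeFn_compMeasurePreserving f hσ] with x hmul hweight hcomp
  rw [hweight, hcomp] at hmul
  exact hmul

theorem measurePreserving_toIcoMod_sub {T : ℝ} (hT : 0 < T) (a d : ℝ) :
    MeasurePreserving (fun x => toIcoMod hT a (d - x))
      (volume.restrict (Ico a (a + T))) (volume.restrict (Ico a (a + T))) := by
  have : Fact (0 < T) := ⟨hT⟩
  have hmk : MeasurePreserving ((↑) : ℝ → AddCircle T) (volume.restrict (Ico a (a + T)))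
      volume := by
    rw [restrict_Ico_eq_restrict_Ioc]
    exact AddCircle.measurePreserving_mk T a
  have hlift_meas : Measurable fun z : AddCircle T => (AddCircle.equivIco T a z : ℝ) :=
    measurable_subtype_coe.comp (AddCircle.measurableEquivIco T a).measurable
  have hlift : MeasurePreserving (fun z : AddCircle T => (AddCircle.equivIco T a z : ℝ)) volume
      (volume.restrict (Ico a (a + T))) := by
    refine ⟨hlift_meas, ?_⟩
    rw [← hmk.map_eq, Measure.map_map hlift_meas hmk.measurable]
    refine (Measure.map_congr ?_).trans Measure.map_id
    filter_upwards [ae_restrict_mem measurableSet_Ico] with x hx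
    simp [AddCircle.equivIco_coe_eq hx]
  exact (hlift.comp (Measure.measurePreserving_sub_left volume (d : AddCircle T))).comp hmk

end Measure

section FundamentalDomain

variable {E : Type*}

/-- The representative of a point of the plane, modulo `2πℤ²`, in the fundamental domain
`[0, 2π) × [0, 2π)`. -/
def fold (p : ℝ × ℝ) : ℝ × ℝ :=
  (toIcoMod two_pi_pos 0 p.1, toIcoMod two_pi_pos 0 p.2)

theorem fold_add_lattice (p : ℝ × ℝ) :
    fold p + toIcoDiv two_pi_pos 0 p.1 • (2 * π, 0) + toIcoDiv two_pi_pos 0 p.2 • (0, 2 * π) =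
      p := by
  ext <;> simp [fold]

theorem apply_fold_of_periodic {g : ℝ × ℝ → E} (hg_fst : Function.Periodic g (2 * π, 0))
    (hg_snd : Function.Periodic g (0, 2 * π)) (p : ℝ × ℝ) : g (fold p) = g p := by
  conv_rhs => rw [← fold_add_lattice p]
  rw [hg_snd.zsmul, hg_fst.zsmul]

theorem measurable_toIcoDiv {T : ℝ} (hT : 0 < T) (a : ℝ) : Measurable (toIcoDiv hT a) := by
  simp only [funext (toIcoDiv_eq_floor hT a)]
  fun_prop

theorem measurable_fold : Measurable fold := by
  have hmod : Measurable (toIcoMod two_pi_pos 0) := by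
    have hdiv := measurable_toIcoDiv two_pi_pos 0
    unfold toIcoMod
    fun_prop
  unfold fold
  fun_prop

/-- The closure of the fundamental domain. -/
def square : Set (ℝ × ℝ) := Icc 0 (2 * π) ×ˢ Icc 0 (2 * π)

theorem isCompact_square : IsCompact square := isCompact_Icc.prod isCompact_Icc

theorem fold_mem_square (p : ℝ × ℝ) : fold p ∈ square :=
  ⟨Ico_subset_Icc_self (toIcoMod_mem_Ico' two_pi_pos p.1),
    Ico_subset_Icc_self (toIcoMod_mem_Ico' two_pi_pos p.2)⟩

theorem square_subset_closure_interior : square ⊆ closure (interior square) := by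
  rw [square, interior_prod_eq, closure_prod_eq, closure_interior_Icc two_pi_pos.ne]

theorem torusMeasure_eq_prod : torusMeasure =
    (volume.restrict (Ico 0 (2 * π))).prod (volume.restrict (Ico 0 (2 * π))) := by
  rw [torusMeasure, Measure.prod_restrict, Measure.volume_eq_prod]

theorem torusMeasure_eq_restrict_square : torusMeasure = volume.restrict square := by
  rw [torusMeasure_eq_prod, restrict_Ico_eq_restrict_Icc, Measure.prod_restrict, square,
    Measure.volume_eq_prod]

instance : IsFiniteMeasure torusMeasure := by
  rw [torusMeasure_eq_restrict_square]
  exact ⟨by simpa using isCompact_square.measure_lt_top⟩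

theorem measurePreserving_fold_sub (d : ℝ × ℝ) :
    MeasurePreserving (fun p => fold (d - p)) torusMeasure torusMeasure := by
  have h := measurePreserving_toIcoMod_sub two_pi_pos 0
  simp only [zero_add] at h
  rw [torusMeasure_eq_prod]
  exact (h d.1).prod (h d.2)

theorem eqOn_square_of_ae_eq [TopologicalSpace E] [T2Space E] {f g : ℝ × ℝ → E}
    (h : f =ᵐ[torusMeasure] g) (hf : Continuous f) (hg : Continuous g) : EqOn f g square := by
  rw [torusMeasure_eq_restrict_square] at h
  exact Measure.eqOn_of_ae_eq h hf.continuousOn hg.continuousOn square_subset_closure_interior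

variable [NormedAddCommGroup E]

theorem memLp_torusMeasure_of_continuous {p : ENNReal} {φ : ℝ × ℝ → E} (hφ : Continuous φ) :
    MemLp φ p torusMeasure := by
  obtain ⟨C, hC⟩ := isCompact_square.exists_bound_of_continuousOn hφ.continuousOn
  refine MemLp.of_bound hφ.aestronglyMeasurable C ?_
  rw [torusMeasure_eq_restrict_square]
  filter_upwards [ae_restrict_mem isCompact_square.measurableSet] with p hp using hC p hp

theorem integrable_torusMeasure_of_continuous {φ : ℝ × ℝ → E} (hφ : Continuous φ) :
    Integrable φ torusMeasure :=
  memLp_one_iff_integrable.1 (memLp_torusMeasure_of_continuous hφ)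

theorem integral_torusMeasure_reflect [NormedSpace ℝ E] {g : ℝ × ℝ → E} (hg : Continuous g)
    (hg_fst : Function.Periodic g (2 * π, 0)) (hg_snd : Function.Periodic g (0, 2 * π))
    (d : ℝ × ℝ) : ∫ p, g (d - p) ∂torusMeasure = ∫ p, g p ∂torusMeasure := by
  have hσ := measurePreserving_fold_sub d
  conv_rhs => rw [← hσ.map_eq]
  rw [integral_map hσ.measurable.aemeasurable hg.aestronglyMeasurable]
  simp only [apply_fold_of_periodic hg_fst hg_snd]

end FundamentalDomain

namespace MagneticTorus

variable {k : ℤ} {M : MagneticTorus k} {V : ℝ × ℝ → ℝ}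

theorem isSection_hamiltonian (hV_fst : Function.Periodic V (2 * π, 0))
    (hV_snd : Function.Periodic V (0, 2 * π)) {ψ : ℝ × ℝ → ℂ} (hψ_smooth : ContDiff ℝ ∞ ψ)
    (hψ : M.IsSection ψ) : M.IsSection (M.hamiltonian V ψ) := by
  have hD₁ : ∀ φ, Differentiable ℝ φ → M.IsSection φ → M.IsSection (M.D₁ φ) :=
    fun φ hdiff h => isSection_covDeriv h hdiff M.A₁_add_fst M.A₁_add_snd
  have hD₂ : ∀ φ, Differentiable ℝ φ → M.IsSection φ → M.IsSection (M.D₂ φ) :=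
    fun φ hdiff h => isSection_covDeriv h hdiff M.A₂_add_fst M.A₂_add_snd
  have hψ_diff : Differentiable ℝ ψ := hψ_smooth.differentiable (by simp)
  have hD₁D₁ := hD₁ (M.D₁ ψ)
    ((contDiff_covDeriv M.smooth_A₁ (1, 0) hψ_smooth).differentiable (by simp))
    (hD₁ ψ hψ_diff hψ)
  have hD₂D₂ := hD₂ (M.D₂ ψ)
    ((contDiff_covDeriv M.smooth_A₂ (0, 1) hψ_smooth).differentiable (by simp))
    (hD₂ ψ hψ_diff hψ)
  refine isSection_iff.2 ⟨fun p => ?_, fun p => ?_⟩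
  · simp only [hamiltonian, hD₁D₁.apply_add_fst, hD₂D₂.apply_add_fst, hψ.apply_add_fst, hV_fst p,
      Circle.smul_def, smul_eq_mul]
    ring
  · simp only [hamiltonian, hD₁D₁.apply_add_snd, hD₂D₂.apply_add_snd, hψ.apply_add_snd, hV_snd p,
      Circle.smul_def, smul_eq_mul]
    ring

namespace LandauGauge

variable (L : M.LandauGauge)

/-- The phase by which a section at `p` differs from its value at the representative of `p` in the
fundamental domain. -/
def foldPhase (p : ℝ × ℝ) : ℝ :=
  L.latticePhase (toIcoDiv two_pi_pos 0 p.1) (toIcoDiv two_pi_pos 0 p.2) (fold p)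

theorem measurable_foldPhase : Measurable L.foldPhase := by
  have hΛ := L.smooth.continuous.measurable
  have hdiv : Measurable fun x : ℝ => (toIcoDiv two_pi_pos 0 x : ℝ) :=
    measurable_from_top.comp (measurable_toIcoDiv two_pi_pos 0)
  unfold foldPhase latticePhase
  simp only [fold_add_lattice]
  exact ((hΛ.sub (hΛ.comp measurable_fold)).add ((hdiv.comp measurable_fst).mul
    ((measurable_fold.snd.const_mul _).add_const _))).add ((hdiv.comp measurable_snd).mul_const _)

theorem apply_eq_foldPhase_smul {ψ : ℝ × ℝ → ℂ} (hψ : M.IsSection ψ) (p : ℝ × ℝ) :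
    ψ p = Circle.exp (L.foldPhase p) • ψ (fold p) := by
  rw [foldPhase, ← L.apply_add_lattice hψ, fold_add_lattice]

/-- `P` is the realization of the parity operator at `c` on the Hilbert space of states, whose
elements are functions on the fundamental domain only. -/
def IsParityOperator (c : ℝ × ℝ) (P : StateSpace →L[ℂ] StateSpace) : Prop :=
  ∀ (f : StateSpace) (ψ : ℝ × ℝ → ℂ), M.IsSection ψ →
    f =ᵐ[torusMeasure] ψ → P f =ᵐ[torusMeasure] L.parity c ψ

theorem exists_isParityOperator (c : ℝ × ℝ) :
    ∃ P : StateSpace →L[ℂ] StateSpace, L.IsParityOperator c P := by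
  have hσ := measurePreserving_fold_sub ((2 : ℝ) • c)
  let w : ℝ × ℝ → ℂ := fun p =>
    Circle.exp (L.parityPhase c p + L.foldPhase ((2 : ℝ) • c - p))
  have hw : Measurable w := by
    have hparity := (L.contDiff_parityPhase c).continuous.measurable
    have hfold := L.measurable_foldPhase
    simp only [w, Circle.coe_exp]
    fun_prop
  obtain ⟨P, hP⟩ := exists_weightedComposition (E := ℂ) (p := 2) hσ
    (memLp_top_of_bound hw.aestronglyMeasurable 1 (ae_of_all _ fun p => (Circle.norm_coe _).le))
  refine ⟨P, fun f ψ hψ hf => ?_⟩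
  filter_upwards [hP f, hσ.quasiMeasurePreserving.ae_eq_comp hf] with p hPf hfψ
  rw [hPf, parity, twistedReflection, L.apply_eq_foldPhase_smul hψ, smul_smul, ← Circle.exp_add]
  exact congrArg (w p • ·) hfψ

variable {L} in
theorem IsParityOperator.map_mem_smoothGraph {c : ℝ × ℝ} {P : StateSpace →L[ℂ] StateSpace}
    (hP : L.IsParityOperator c P) (hα : M.holonomyα c.1 ^ 2 = 1) (hβ : M.holonomyβ c.2 ^ 2 = 1)
    (hV_fst : Function.Periodic V (2 * π, 0)) (hV_snd : Function.Periodic V (0, 2 * π))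
    (hV_symm : ∀ p, V ((2 : ℝ) • c - p) = V p) {fg : StateSpace × StateSpace}
    (hfg : fg ∈ M.smoothGraph V) : (P fg.1, P fg.2) ∈ M.smoothGraph V := by
  obtain ⟨u, hu_smooth, hu, hf, hg⟩ := hfg
  refine ⟨L.parity c u, L.contDiff_parity c hu_smooth, L.isSection_parity hα hβ hu,
    hP fg.1 u hu hf, ?_⟩
  rw [L.hamiltonian_parity hV_symm hu_smooth]
  exact hP fg.2 _ (isSection_hamiltonian hV_fst hV_snd hu_smooth hu) hg

end LandauGauge

namespace IsHeatSemigroup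

variable {S : ℝ → StateSpace →L[ℂ] StateSpace}

theorem isC0Semigroup (hS : M.IsHeatSemigroup V S) :
    IsC0Semigroup fun t => (S t).restrictScalars ℝ where
  zero := by rw [hS.zero]; rfl
  add s t hs ht := by rw [hS.add s t hs ht]; rfl
  strongly_continuous := hS.strongly_continuous

theorem mem_generatorGraph_iff (hS : M.IsHeatSemigroup V S) (f g : StateSpace) :
    (f, g) ∈ generatorGraph (fun t => (S t).restrictScalars ℝ) ↔
      (f, -g) ∈ closure (M.smoothGraph V) := by
  have hslope : ∀ t : ℝ, -slope (fun t => S t f) 0 t = (t : ℂ)⁻¹ • (f - S t f) := fun t => by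
    rw [slope_def_module, hS.zero, sub_zero, ← smul_neg, neg_sub, ← Complex.ofReal_inv,
      Complex.coe_smul]
    rfl
  rw [← hS.generator, generatorGraph, mem_ofPred_eq, hasDerivWithinAt_iff_tendsto_slope,
    Ici_sdiff_left, ← tendsto_neg_iff]
  exact tendsto_congr hslope

theorem commute_of_mapsTo_smoothGraph (hS : M.IsHeatSemigroup V S)
    {P : StateSpace →L[ℂ] StateSpace}
    (hP : ∀ fg ∈ M.smoothGraph V, (P fg.1, P fg.2) ∈ M.smoothGraph V) {t : ℝ} (ht : 0 ≤ t)
    (f : StateSpace) : P (S t f) = S t (P f) := by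
  refine hS.isC0Semigroup.intertwine hS.isC0Semigroup (P := P.restrictScalars ℝ) ?_ ht f
  rintro ⟨f, g⟩ hfg
  rw [hS.mem_generatorGraph_iff] at hfg ⊢
  have hclosure := map_mem_closure
    (f := fun fg : StateSpace × StateSpace => (P fg.1, P fg.2)) (by fun_prop) hfg hP
  rwa [map_neg] at hclosure

end IsHeatSemigroup

end MagneticTorus

/-! ### Parity of the heat kernel -/

theorem exists_odd_of_circleExp {s t : ℝ} (hs : (Circle.exp s : ℂ) = 1)
    (ht : (Circle.exp t : ℂ) = -1) : ∃ m : ℤ, Odd m ∧ t = s + m * π := by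
  have hst : Circle.exp (t - s - π) = 1 := by
    rw [← Circle.coe_eq_one]
    simp [Circle.exp_sub, circleExp_pi, hs, ht]
  obtain ⟨n, hn⟩ := Circle.exp_eq_one.1 hst
  exact ⟨2 * n + 1, odd_two_mul_add_one n, by push_cast; linarith⟩

namespace MagneticTorus

variable {k : ℤ} {M : MagneticTorus k} {V : ℝ × ℝ → ℝ} {ψ φ : ℝ × ℝ → ℂ}

namespace IsSection

theorem const_smul (hψ : M.IsSection ψ) (r : ℂ) : M.IsSection fun p => r • ψ p :=
  isSection_iff.2 ⟨fun p => by rw [hψ.apply_add_fst, smul_comm],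
    fun p => by rw [hψ.apply_add_snd, smul_comm]⟩

theorem sub (hψ : M.IsSection ψ) (hφ : M.IsSection φ) : M.IsSection fun p => ψ p - φ p :=
  isSection_iff.2 ⟨fun p => by rw [hψ.apply_add_fst, hφ.apply_add_fst, smul_sub],
    fun p => by rw [hψ.apply_add_snd, hφ.apply_add_snd, smul_sub]⟩

theorem periodic_conj_mul_fst (hψ : M.IsSection ψ) (hφ : M.IsSection φ) :
    Function.Periodic (fun p => (starRingEnd ℂ) (ψ p) * φ p) (2 * π, 0) := fun p => by
  simp only [hψ.apply_add_fst, hφ.apply_add_fst, conj_circle_smul, smul_mul_smul_comm,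
    inv_mul_cancel, one_smul]

theorem periodic_conj_mul_snd (hψ : M.IsSection ψ) (hφ : M.IsSection φ) :
    Function.Periodic (fun p => (starRingEnd ℂ) (ψ p) * φ p) (0, 2 * π) := fun p => by
  simp only [hψ.apply_add_snd, hφ.apply_add_snd, conj_circle_smul, smul_mul_smul_comm,
    inv_mul_cancel, one_smul]

theorem eq_of_ae_eq (hψ : M.IsSection ψ) (hφ : M.IsSection φ) (hψ_cont : Continuous ψ)
    (hφ_cont : Continuous φ) (h : ψ =ᵐ[torusMeasure] φ) : ψ = φ := by
  obtain ⟨L⟩ : Nonempty M.LandauGauge := inferInstance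
  funext p
  rw [L.apply_eq_foldPhase_smul hψ, L.apply_eq_foldPhase_smul hφ,
    eqOn_square_of_ae_eq h hψ_cont hφ_cont (fold_mem_square p)]

end IsSection

variable (M) in
/-- Continuous sections of `E ⊠ E*` over `T² × T²`, the integral kernels of smoothing operators on
sections of `E`. Being a section of the dual bundle is expressed by complex conjugation. -/
structure IsContinuousKernel (G : ℝ × ℝ → ℝ × ℝ → ℂ) : Prop where
  continuous : Continuous fun q : (ℝ × ℝ) × (ℝ × ℝ) => G q.1 q.2
  section_left : ∀ z, M.IsSection fun x => G x z
  section_right : ∀ x, M.IsSection fun z => (starRingEnd ℂ) (G x z)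

namespace IsContinuousKernel

variable {G G' : ℝ × ℝ → ℝ × ℝ → ℂ}

theorem continuous_right (hG : M.IsContinuousKernel G) (x : ℝ × ℝ) : Continuous (G x) :=
  hG.continuous.comp (by fun_prop : Continuous fun z => (x, z))

theorem sub (hG : M.IsContinuousKernel G) (hG' : M.IsContinuousKernel G') :
    M.IsContinuousKernel fun x z => G x z - G' x z where
  continuous := hG.continuous.sub hG'.continuous
  section_left z := (hG.section_left z).sub (hG'.section_left z)
  section_right x := by
    simpa only [map_sub] using (hG.section_right x).sub (hG'.section_right x)

theorem adjoint (hG : M.IsContinuousKernel G) :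
    M.IsContinuousKernel fun x z => (starRingEnd ℂ) (G z x) where
  continuous := Complex.continuous_conj.comp (hG.continuous.comp continuous_swap)
  section_left := hG.section_right
  section_right x := by simpa only [Complex.conj_conj] using hG.section_left x

theorem isSection_integral (hG : M.IsContinuousKernel G) (φ : ℝ × ℝ → ℂ) :
    M.IsSection fun x => ∫ z, G x z * φ z ∂torusMeasure := by
  refine isSection_iff.2 ⟨fun p => ?_, fun p => ?_⟩
  · simp only [(hG.section_left _).apply_add_fst, Circle.smul_def, smul_eq_mul, mul_assoc,
      integral_const_mul]
  · simp only [(hG.section_left _).apply_add_snd, Circle.smul_def, smul_eq_mul, mul_assoc,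
      integral_const_mul]

theorem continuous_integral (hG : M.IsContinuousKernel G) (hφ : Continuous φ) :
    Continuous fun x => ∫ z, G x z * φ z ∂torusMeasure := by
  rw [torusMeasure_eq_restrict_square]
  exact continuous_parametric_integral_of_continuous (f := fun x z => G x z * φ z)
    (hG.continuous.mul (hφ.comp continuous_snd)) isCompact_square

theorem eq_zero_of_integral_eq_zero (hG : M.IsContinuousKernel G)
    (h : ∀ φ : ℝ × ℝ → ℂ, Continuous φ → M.IsSection φ →
      ∀ᵐ x ∂torusMeasure, ∫ z, G x z * φ z ∂torusMeasure = 0) : G = 0 := by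
  have hzero : M.IsSection 0 := isSection_iff.2 (by simp)
  funext x
  have hGx := hG.continuous_right x
  have hφ : Continuous fun z => (starRingEnd ℂ) (G x z) := Complex.continuous_conj.comp hGx
  have hint := congrFun ((hG.isSection_integral _).eq_of_ae_eq hzero
    (hG.continuous_integral hφ) continuous_zero (h _ hφ (hG.section_right x))) x
  simp only [Complex.mul_conj, integral_complex_ofReal, Pi.zero_apply,
    Complex.ofReal_eq_zero] at hint
  rw [integral_eq_zero_iff_of_nonneg (fun z => Complex.normSq_nonneg _)
    (integrable_torusMeasure_of_continuous (Complex.continuous_normSq.comp hGx))] at hint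
  have hconj := (hG.section_right x).eq_of_ae_eq hzero hφ continuous_zero
    (hint.mono fun z hz => by simpa using hz)
  funext z
  simpa using congrFun hconj z

theorem eq_of_integral_eq (hG : M.IsContinuousKernel G) (hG' : M.IsContinuousKernel G')
    (h : ∀ φ : ℝ × ℝ → ℂ, Continuous φ → M.IsSection φ → ∀ᵐ x ∂torusMeasure,
      ∫ z, G x z * φ z ∂torusMeasure = ∫ z, G' x z * φ z ∂torusMeasure) : G = G' := by
  have hsub := (hG.sub hG').eq_zero_of_integral_eq_zero fun φ hφ hφ_section => by
    filter_upwards [h φ hφ hφ_section] with x hx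
    have hint := integrable_torusMeasure_of_continuous ((hG.continuous_right x).fun_mul hφ)
    have hint' := integrable_torusMeasure_of_continuous ((hG'.continuous_right x).fun_mul hφ)
    simp only [sub_mul, integral_sub hint hint', hx, sub_self]
  funext x z
  exact sub_eq_zero.1 (congrFun (congrFun hsub x) z)

end IsContinuousKernel

namespace LandauGauge

variable (L : M.LandauGauge) {c : ℝ × ℝ}

theorem continuous_parity (c : ℝ × ℝ) (hψ : Continuous ψ) : Continuous (L.parity c ψ) :=
  contDiff_zero.1 (contDiff_twistedReflection
    (contDiff_zero.2 (L.contDiff_parityPhase c).continuous) c (contDiff_zero.2 hψ))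

theorem integral_conj_mul_parity (hα : M.holonomyα c.1 ^ 2 = 1) (hβ : M.holonomyβ c.2 ^ 2 = 1)
    (hψ_cont : Continuous ψ) (hψ : M.IsSection ψ) (hφ_cont : Continuous φ) (hφ : M.IsSection φ) :
    ∫ p, (starRingEnd ℂ) (ψ p) * L.parity c φ p ∂torusMeasure =
      ∫ p, (starRingEnd ℂ) (L.parity c ψ p) * φ p ∂torusMeasure := by
  have hparity := L.isSection_parity hα hβ hψ
  have hconj_cont : Continuous fun p => (starRingEnd ℂ) (L.parity c ψ p) :=
    Complex.continuous_conj.comp (L.continuous_parity c hψ_cont)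
  rw [← integral_torusMeasure_reflect (hconj_cont.fun_mul hφ_cont)
    (hparity.periodic_conj_mul_fst hφ) (hparity.periodic_conj_mul_snd hφ) ((2 : ℝ) • c)]
  congr with p
  simp only [parity, twistedReflection, sub_sub_cancel,
    L.parityPhase_reflect, conj_circle_smul, Circle.exp_neg, inv_inv, smul_mul_assoc,
    mul_smul_comm]

theorem isContinuousKernel_parity_left {G : ℝ × ℝ → ℝ × ℝ → ℂ} (hα : M.holonomyα c.1 ^ 2 = 1)
    (hβ : M.holonomyβ c.2 ^ 2 = 1) (hG : M.IsContinuousKernel G) :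
    M.IsContinuousKernel fun x z => L.parity c (fun x => G x z) x where
  continuous := by
    have hphase := (L.contDiff_parityPhase c).continuous
    have hG_reflect : Continuous fun q : (ℝ × ℝ) × (ℝ × ℝ) => G ((2 : ℝ) • c - q.1) q.2 :=
      hG.continuous.comp (by fun_prop :
        Continuous fun q : (ℝ × ℝ) × (ℝ × ℝ) => ((2 : ℝ) • c - q.1, q.2))
    exact (Circle.exp.continuous.comp (hphase.comp continuous_fst)).smul hG_reflect
  section_left z := L.isSection_parity hα hβ (hG.section_left z)
  section_right x := by
    simp only [parity, twistedReflection, conj_circle_smul]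
    exact (hG.section_right _).const_smul _

theorem isContinuousKernel_parity_right {G : ℝ × ℝ → ℝ × ℝ → ℂ} (hα : M.holonomyα c.1 ^ 2 = 1)
    (hβ : M.holonomyβ c.2 ^ 2 = 1) (hG : M.IsContinuousKernel G) :
    M.IsContinuousKernel fun x z =>
      (starRingEnd ℂ) (L.parity c (fun z => (starRingEnd ℂ) (G x z)) z) :=
  (L.isContinuousKernel_parity_left hα hβ hG.adjoint).adjoint

end LandauGauge

namespace IsHeatKernel

variable {K : ℝ → ℝ × ℝ → ℝ × ℝ → ℂ} {T : ℝ} {c : ℝ × ℝ}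

theorem isContinuousKernel (hK : M.IsHeatKernel V K) (hT : 0 < T) : M.IsContinuousKernel (K T) where
  continuous := hK.continuous T hT
  section_left := hK.section_left T hT
  section_right := hK.section_right T hT

theorem parity_left_eq_parity_right (hK : M.IsHeatKernel V K) (L : M.LandauGauge)
    (hα : M.holonomyα c.1 ^ 2 = 1) (hβ : M.holonomyβ c.2 ^ 2 = 1)
    (hV_fst : Function.Periodic V (2 * π, 0)) (hV_snd : Function.Periodic V (0, 2 * π))
    (hV_symm : ∀ p, V ((2 : ℝ) • c - p) = V p) (hT : 0 < T) (x z : ℝ × ℝ) :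
    L.parity c (fun x => K T x z) x =
      (starRingEnd ℂ) (L.parity c (fun z => (starRingEnd ℂ) (K T x z)) z) := by
  obtain ⟨S, hS, hS_kernel⟩ := hK.kernel
  obtain ⟨P, hP⟩ := L.exists_isParityOperator c
  have hK_T := hK.isContinuousKernel hT
  refine congrFun (congrFun ((L.isContinuousKernel_parity_left hα hβ hK_T).eq_of_integral_eq
    (L.isContinuousKernel_parity_right hα hβ hK_T) fun φ hφ_cont hφ => ?_) x) z
  have hS_ae : ∀ (f : StateSpace) (u : ℝ × ℝ → ℂ), f =ᵐ[torusMeasure] u →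
      S T f =ᵐ[torusMeasure] fun x => ∫ z, K T x z * u z ∂torusMeasure := fun f u hf =>
    (hS_kernel T hT f).trans (ae_of_all _ fun x =>
      integral_congr_ae (hf.mono fun z hz => congrArg (K T x z * ·) hz))
  let f : StateSpace := (memLp_torusMeasure_of_continuous hφ_cont).toLp
  have hf : f =ᵐ[torusMeasure] φ := (memLp_torusMeasure_of_continuous hφ_cont).coeFn_toLp
  have hcomm : P (S T f) = S T (P f) := hS.commute_of_mapsTo_smoothGraph
    (fun _ => hP.map_mem_smoothGraph hα hβ hV_fst hV_snd hV_symm) hT.le f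
  filter_upwards [hP (S T f) _ (hK_T.isSection_integral φ) (hS_ae f φ hf),
    hS_ae (P f) _ (hP f φ hφ hf)] with x hPSf hSPf
  calc ∫ z, L.parity c (fun x => K T x z) x * φ z ∂torusMeasure
      = L.parity c (fun x => ∫ z, K T x z * φ z ∂torusMeasure) x := by
        simp only [LandauGauge.parity, twistedReflection, Circle.smul_def, smul_eq_mul, mul_assoc,
          integral_const_mul]
    _ = ∫ z, K T x z * L.parity c φ z ∂torusMeasure := by rw [← hPSf, hcomm, hSPf]
    _ = ∫ z, (starRingEnd ℂ) (L.parity c (fun z => (starRingEnd ℂ) (K T x z)) z) * φ z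
          ∂torusMeasure := by
        rw [← L.integral_conj_mul_parity hα hβ (ψ := fun z => (starRingEnd ℂ) (K T x z))
          (Complex.continuous_conj.comp (hK_T.continuous_right x)) (hK_T.section_right x) hφ_cont
          hφ]
        simp only [Complex.conj_conj]

theorem apply_half_periods_eq_zero (hK : M.IsHeatKernel V K) (hα : M.holonomyα c.1 = 1)
    (hβ : M.holonomyβ c.2 = 1) (hV_fst : Function.Periodic V (2 * π, 0))
    (hV_snd : Function.Periodic V (0, 2 * π)) (hV_symm : ∀ p, V ((2 : ℝ) • c - p) = V p)
    (hT : 0 < T) {m n m' n' : ℤ} (heven : Even (k * m * n)) (hodd : Odd (k * m' * n')) :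
    K T (c + m • (π, 0) + n • (0, π)) (c + m' • (π, 0) + n' • (0, π)) = 0 := by
  obtain ⟨L⟩ : Nonempty M.LandauGauge := inferInstance
  have hK_T := hK.isContinuousKernel hT
  have hparity := hK.parity_left_eq_parity_right L (by rw [hα, one_pow]) (by rw [hβ, one_pow])
    hV_fst hV_snd hV_symm hT
    (c + m • (π, 0) + n • (0, π)) (c + m' • (π, 0) + n' • (0, π))
  rw [L.parity_apply_half_period hα hβ (hK_T.section_left _),
    L.parity_apply_half_period hα hβ (hK_T.section_right _), heven.neg_one_zpow,
    hodd.neg_one_zpow] at hparity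
  simpa only [one_mul, neg_mul, map_neg, Complex.conj_conj, self_eq_neg] using hparity

end IsHeatKernel

theorem exists_odd_of_holonomyα {x x' : ℝ} (hx : M.holonomyα x = 1) (hx' : M.holonomyα x' = -1) :
    ∃ m : ℤ, Odd m ∧ k * x' = k * x + m * π := by
  obtain ⟨L⟩ : Nonempty M.LandauGauge := inferInstance
  rw [L.holonomyα_eq] at hx hx'
  obtain ⟨m, hm, hm_eq⟩ := exists_odd_of_circleExp hx hx'
  exact ⟨m, hm, by linarith⟩

theorem exists_odd_of_holonomyβ {y y' : ℝ} (hy : M.holonomyβ y = 1) (hy' : M.holonomyβ y' = -1) :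
    ∃ n : ℤ, Odd n ∧ k * y' = k * y + n * π := by
  obtain ⟨L⟩ : Nonempty M.LandauGauge := inferInstance
  rw [L.holonomyβ_eq] at hy hy'
  obtain ⟨n, hn, hn_eq⟩ := exists_odd_of_circleExp hy hy'
  exact ⟨-n, hn.neg, by push_cast; linarith⟩

end MagneticTorus

end HallTorus

end

theorem proposition3p1_general {k : ℤ} (hk : Odd k) (M : HallTorus.MagneticTorus k)
    {V : ℝ × ℝ → ℝ} (hV_fst : Function.Periodic V (2 * Real.pi, 0))
    (hV_snd : Function.Periodic V (0, 2 * Real.pi)) {φ₁p φ₁m φ₂p φ₂m : ℝ}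
    (hφ₁p : M.holonomyα φ₁p = 1) (hφ₁m : ∃ m : ℤ, Odd m ∧ φ₁m = φ₁p + m * Real.pi)
    (hφ₂p : M.holonomyβ φ₂p = 1) (hφ₂m : ∃ n : ℤ, Odd n ∧ φ₂m = φ₂p + n * Real.pi)
    (hV_symm : ∀ x y : ℝ, V (2 * φ₁p - x, 2 * φ₂p - y) = V (x, y))
    {K : ℝ → ℝ × ℝ → ℝ × ℝ → ℂ} (hK : M.IsHeatKernel V K) (T : ℝ) (hT : 0 < T) :
    K T (φ₁p, φ₂p) (φ₁m, φ₂m) = 0 ∧ K T (φ₁p, φ₂m) (φ₁m, φ₂m) = 0 ∧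
      K T (φ₁m, φ₂p) (φ₁m, φ₂m) = 0 := by
  obtain ⟨m, hm, rfl⟩ := hφ₁m
  obtain ⟨n, hn, rfl⟩ := hφ₂m
  have hzero : ∀ m' n' : ℤ, Even (k * m' * n') →
      K T (φ₁p + m' * Real.pi, φ₂p + n' * Real.pi) (φ₁p + m * Real.pi, φ₂p + n * Real.pi) = 0 :=
    fun m' n' heven => by
      simpa using hK.apply_half_periods_eq_zero (c := (φ₁p, φ₂p)) hφ₁p hφ₂p hV_fst hV_snd
        (fun p => hV_symm p.1 p.2) hT heven ((hk.mul hm).mul hn)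
  exact ⟨by simpa using hzero 0 0 (by simp), by simpa using hzero 0 n (by simp),
    by simpa using hzero m 0 (by simp)⟩

theorem proposition3p1
    (M : HallTorus.MagneticTorus 1)
    (V : ℝ × ℝ → ℝ) (hV_meas : Measurable V) (hV_bdd : ∃ C : ℝ, ∀ p, |V p| ≤ C)
    (hV_per₁ : ∀ x y : ℝ, V (x + 2 * Real.pi, y) = V (x, y))
    (hV_per₂ : ∀ x y : ℝ, V (x, y + 2 * Real.pi) = V (x, y))
    (φ₁p φ₁m φ₂p φ₂m : ℝ)
    (hφ₁p : M.holonomyα φ₁p = 1) (hφ₁m : M.holonomyα φ₁m = -1)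
    (hφ₂p : M.holonomyβ φ₂p = 1) (hφ₂m : M.holonomyβ φ₂m = -1)
    (hV_symm : ∀ x y : ℝ, V (2 * φ₁p - x, 2 * φ₂p - y) = V (x, y))
    (K : ℝ → ℝ × ℝ → ℝ × ℝ → ℂ) (hK : M.IsHeatKernel V K) :
    ∀ T : ℝ, 0 < T →
      K T (φ₁p, φ₂p) (φ₁m, φ₂m) = 0 ∧
      K T (φ₁p, φ₂m) (φ₁m, φ₂m) = 0 ∧
      K T (φ₁m, φ₂p) (φ₁m, φ₂m) = 0 :=
  proposition3p1_general odd_one M (fun ⟨x, y⟩ => by simpa using hV_per₁ x y)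
    (fun ⟨x, y⟩ => by simpa using hV_per₂ x y)
    hφ₁p (by simpa using HallTorus.MagneticTorus.exists_odd_of_holonomyα hφ₁p hφ₁m)
    hφ₂p (by simpa using HallTorus.MagneticTorus.exists_odd_of_holonomyβ hφ₂p hφ₂m) hV_symm hK
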